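/- Let $n\ge 0$ and $1\le m\le n+1$. Identify the hyperbolic space $\mathbf H^{n+1}$ with the open unit ball $\mathbb B^{n+1}\subset\mathbb R^{n+1}$ with the metric $\frac{4|dx|^2}{(1-|x|^2)^2}$ (Poincaré model), and its sphere at infinity $S^n_\infty$ with the unit sphere $\partial\mathbb B^{n+1}$. Let $\Sigma\subset\mathbb B^{n+1}$ be an embedded $m$-dimensional submanifold of class $C^2$ without boundary that is minimal in $\mathbf H^{n+1}$, that is, its mean curvature vector with respect to the hyperbolic metric vanishes identically. Suppose that there is a set $\Gamma\subset\partial\mathbb B^{n+1}$ such that $\Sigma\cup\Gamma$ is an $m$-dimensional embedded $C^1$-submanifold with boundary of $\mathbb R^{n+1}$, with boundary $\Gamma$. Then $\Sigma$ meets the sphere at infinity orthogonally: at every point $p\in\Gamma$ the normal line to $\partial\mathbb B^{n+1}$ at $p$ is contained in the tangent space $T_p(\Sigma\cup\Gamma)$. -/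

import Mathlib

open scoped RealInnerProductSpace

namespace HypMin

/-- Euclidean space `ℝ^d`. -/
abbrev Eucl (d : ℕ) : Type := EuclideanSpace ℝ (Fin d)

noncomputable section

/-! ### Hyperbolic geometry of the unit ball (Poincaré model) -/

/-- The hyperbolic metric `4 |dx|² / (1 - |x|²)²` of curvature `-1` on the unit ball of `ℝ^d`,
as a bilinear form on the tangent space `ℝ^d` at the point `x`. -/
def hypMetric {d : ℕ} (x v w : Eucl d) : ℝ :=
  4 / (1 - ‖x‖ ^ 2) ^ 2 * ⟪v, w⟫

/-- The Christoffel symbols of the Levi-Civita connection of the hyperbolic metric at `x`, as a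
bilinear map: `∇_v w = D_v w + Γ_x(v, w)`. It is identified by `christoffel_comm` (no torsion) and
`hypMetric_christoffel` (Koszul's formula in the coordinates of the ball). -/
def christoffel {d : ℕ} (x v w : Eucl d) : Eucl d :=
  (2 / (1 - ‖x‖ ^ 2)) • (⟪x, v⟫ • w + ⟪x, w⟫ • v - ⟪v, w⟫ • x)

theorem christoffel_comm {d : ℕ} (x v w : Eucl d) : christoffel x v w = christoffel x w v := by
  simp only [christoffel, real_inner_comm v w]
  rw [add_comm (⟪x, v⟫ • w)]

theorem fderiv_hypMetric {d : ℕ} {x : Eucl d} (hx : ‖x‖ < 1) (u v w : Eucl d) :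
    fderiv ℝ (fun y => hypMetric y v w) x u
      = 16 * ⟪x, u⟫ / (1 - ‖x‖ ^ 2) ^ 3 * ⟪v, w⟫ := by
  have hpos : (1 - ‖x‖ ^ 2) ≠ 0 := by nlinarith [norm_nonneg x]
  have h1 : HasFDerivAt (fun y : Eucl d => 1 - ‖y‖ ^ 2) (-(2 • innerSL ℝ x)) x :=
    (hasStrictFDerivAt_norm_sq x).hasFDerivAt.const_sub 1
  have h2 : HasDerivAt (fun t : ℝ => 4 / t ^ 2 * ⟪v, w⟫)
      (-8 / (1 - ‖x‖ ^ 2) ^ 3 * ⟪v, w⟫) (1 - ‖x‖ ^ 2) := by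
    have h0 : HasDerivAt (fun t : ℝ => t ^ 2) (2 * (1 - ‖x‖ ^ 2)) (1 - ‖x‖ ^ 2) := by
      simpa using hasDerivAt_pow 2 (1 - ‖x‖ ^ 2)
    have h3 : HasDerivAt (fun t : ℝ => 4 * (t ^ 2)⁻¹ * ⟪v, w⟫) _ (1 - ‖x‖ ^ 2) :=
      ((h0.fun_inv (pow_ne_zero 2 hpos)).const_mul (4 : ℝ)).mul_const ⟪v, w⟫
    convert h3 using 1
    field_simp
    norm_num
    left
    field_simp
    norm_num
  have h := h2.comp_hasFDerivAt x h1
  change fderiv ℝ ((fun t : ℝ => 4 / t ^ 2 * ⟪v, w⟫) ∘ fun y => 1 - ‖y‖ ^ 2) x u = _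
  rw [h.fderiv]
  simp
  ring

/-- Koszul's formula for coordinate vector fields: `christoffel` is the Levi-Civita connection of
`hypMetric`. -/
theorem hypMetric_christoffel {d : ℕ} {x : Eucl d} (hx : ‖x‖ < 1) (v w z : Eucl d) :
    hypMetric x (christoffel x v w) z =
      (1 / 2) * (fderiv ℝ (fun y => hypMetric y w z) x v
        + fderiv ℝ (fun y => hypMetric y v z) x w
        - fderiv ℝ (fun y => hypMetric y v w) x z) := by
  have hpos : (1 - ‖x‖ ^ 2) ≠ 0 := by nlinarith [norm_nonneg x]
  rw [fderiv_hypMetric hx, fderiv_hypMetric hx, fderiv_hypMetric hx]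
  simp only [hypMetric, christoffel, inner_smul_left, inner_add_left, inner_sub_left,
    conj_trivial]
  field_simp
  ring

/-- The hyperbolic metric is conformal, so hyperbolic and Euclidean orthogonality agree. -/
theorem hypMetric_eq_zero_iff {d : ℕ} {x : Eucl d} (hx : ‖x‖ < 1) (v w : Eucl d) :
    hypMetric x v w = 0 ↔ ⟪v, w⟫ = 0 := by
  have hpos : (1 - ‖x‖ ^ 2) ≠ 0 := by nlinarith [norm_nonneg x]
  simp [hypMetric, hpos]

/-! ### Mean curvature in a local parametrization -/

/-- The coordinate vector field `∂ᵢ F` of a map `F` from (a part of) `ℝ^m`. -/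
def partialD {m d : ℕ} (F : Eucl m → Eucl d) (i : Fin m) (u : Eucl m) : Eucl d :=
  fderiv ℝ F u (EuclideanSpace.single i 1)

/-- The tangent space of the parametrized submanifold `F` at `F u`. -/
def paramTangent {m d : ℕ} (F : Eucl m → Eucl d) (u : Eucl m) : Submodule ℝ (Eucl d) :=
  LinearMap.range (fderiv ℝ F u).toLinearMap

/-- The matrix of the metric induced by the hyperbolic metric (first fundamental form). -/
def firstForm {m d : ℕ} (F : Eucl m → Eucl d) (u : Eucl m) : Matrix (Fin m) (Fin m) ℝ :=
  Matrix.of fun i j => hypMetric (F u) (partialD F i u) (partialD F j u)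

/-- The second fundamental form `II(∂ᵢ, ∂ⱼ) = (∇_{∂ᵢ F} ∂ⱼ F)^⊥` with respect to the hyperbolic
metric. The normal component is the same for the Euclidean and for the hyperbolic inner product,
by `hypMetric_eq_zero_iff`. -/
def secondForm {m d : ℕ} (F : Eucl m → Eucl d) (u : Eucl m) (i j : Fin m) : Eucl d :=
  (paramTangent F u)ᗮ.starProjection
    (partialD (partialD F j) i u + christoffel (F u) (partialD F i u) (partialD F j u))

/-- The mean curvature vector `H = ∑ g^{ij} II(∂ᵢ, ∂ⱼ)` with respect to the hyperbolic metric. -/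
def meanCurvature {m d : ℕ} (F : Eucl m → Eucl d) (u : Eucl m) : Eucl d :=
  ∑ i, ∑ j, (firstForm F u)⁻¹ i j • secondForm F u i j

/-- `F` is a `C^2` local parametrization, on the open set `U` of `ℝ^m`, of a piece of `S`. -/
structure IsLocalParam {m d : ℕ} (F : Eucl m → Eucl d) (U : Set (Eucl m)) (S : Set (Eucl d)) :
    Prop where
  isOpen : IsOpen U
  contDiffOn : ContDiffOn ℝ 2 F U
  immersion : ∀ u ∈ U, Function.Injective (fderiv ℝ F u)
  mapsTo : Set.MapsTo F U S

/-- An `m`-dimensional `C^2` submanifold `S` of the unit ball is minimal in hyperbolic space if its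
mean curvature vector vanishes identically (in every local parametrization). -/
def IsMinimal {d : ℕ} (m : ℕ) (S : Set (Eucl d)) : Prop :=
  ∀ (F : Eucl m → Eucl d) (U : Set (Eucl m)), IsLocalParam F U S →
    ∀ u ∈ U, meanCurvature F u = 0

/-! ### Submanifolds with boundary and tangent spaces -/

/-- The model half-space `{z : z₀ ≥ 0, z_m = ⋯ = z_n = 0}` of dimension `m` in `ℝ^(n+1)`, for
`1 ≤ m ≤ n + 1`. Its boundary is the part where `z₀ = 0`. -/
def halfSpace (n m : ℕ) : Set (Eucl (n + 1)) :=
  {z | 0 ≤ z 0 ∧ ∀ i : Fin (n + 1), m ≤ i.val → z i = 0}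

/-- `M` is an `m`-dimensional (embedded) `C^k` submanifold of `ℝ^(n+1)` with boundary exactly `B`,
for `1 ≤ m ≤ n + 1`: around each of its points there is a `C^k` diffeomorphism of open sets of
`ℝ^(n+1)` that straightens the pair `(M, B)` to the half-space and its boundary.
(Around an interior point the image of the chart can be taken inside `{z₀ > 0}`;
`B = ∅` gives submanifolds without boundary. `M` need not be closed or connected.) -/
def IsSubmanifoldWithBoundary {n : ℕ} (k : WithTop ℕ∞) (m : ℕ) (M B : Set (Eucl (n + 1))) :
    Prop :=
  B ⊆ M ∧ ∀ p ∈ M, ∃ Φ : OpenPartialHomeomorph (Eucl (n + 1)) (Eucl (n + 1)),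
    p ∈ Φ.source ∧ ContDiffOn ℝ k Φ Φ.source ∧ ContDiffOn ℝ k Φ.symm Φ.target ∧
    (∀ x ∈ Φ.source, x ∈ M ↔ Φ x ∈ halfSpace n m) ∧
    (∀ x ∈ Φ.source, x ∈ B ↔ Φ x ∈ halfSpace n m ∧ Φ x 0 = 0)

/-- The tangent space at `p` of a `C^1` submanifold `M`, possibly with boundary: the span of the
tangent cone, i.e. of all limits of `ρᵢ (pᵢ - p)` with `ρᵢ ≥ 0` and `M ∋ pᵢ → p`. At a boundary
point the tangent cone is a half-space and its span is the full tangent space. -/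
def tangentSpaceAt {d : ℕ} (M : Set (Eucl d)) (p : Eucl d) : Submodule ℝ (Eucl d) :=
  Submodule.span ℝ (posTangentConeAt M p)

/-- `M` meets the hypersurface `T` orthogonally at `p`: the normal line of `T` at `p` is tangent
to `M`. -/
def MeetsOrthogonallyAt {d : ℕ} (M T : Set (Eucl d)) (p : Eucl d) : Prop :=
  (tangentSpaceAt T p)ᗮ ≤ tangentSpaceAt M p

end

end HypMin

/-! For `c` in Euclidean space put `g y = ‖y‖² + 1 - 2⟪y, c⟫`. The quotient `f = g / (1 - ‖y‖²)` is
a linear function of the hyperboloid model, so its hyperbolic Hessian is `f` times the metric. On a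
minimal `m`-dimensional submanifold this gives `Δf = m f`, and `f` has no negative local minimum
(`IsMinimal.no_negative_localMin`).

Suppose `p ∈ Γ` is not in the tangent space `T` of `S ∪ Γ` at `p`. Magnified by `1/t` at `p`, the
submanifold tends to a half-space of `T`, and the totally geodesic hyperplanes `{f = 0}`, which are
spheres orthogonal to the unit sphere, tend to spheres centred at points of `p^⊥`. As `p ∉ T`, every
vector of `T` is the orthogonal projection to `T` of a point of `p^⊥`. So some limit sphere cuts `T`
in a small sphere around a prescribed interior point of the half-space. For small `t` this makes `f`
negative at one point of a compact piece of `S` and positive on the rim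
(`eventually_exists_barrier`). The minimum of `f` on that piece is then a negative local minimum, a
contradiction (`mem_map_coordSubspace`). -/

open scoped RealInnerProductSpace
open Filter Topology

/-! ### Second-order conditions and traces -/

/-- The second-order necessary condition at a local minimum. -/
theorem deriv_deriv_nonneg_of_isLocalMin {φ : ℝ → ℝ} {x : ℝ} (h : IsLocalMin φ x)
    (hc : ContinuousAt φ x) : 0 ≤ deriv (deriv φ) x := by
  by_contra! hneg
  -- A negative second derivative would also make `x` a local maximum, so `φ` would be locally
  -- constant.
  have hmax : IsLocalMax φ x := isLocalMax_of_deriv_deriv_neg hneg h.deriv_eq_zero hc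
  have hconst : φ =ᶠ[𝓝 x] fun _ => φ x := by
    filter_upwards [h, hmax] with y h1 h2 using le_antisymm h2 h1
  have h2 := hconst.deriv.deriv_eq
  simp [h2] at hneg

open scoped MatrixOrder in
/-- The pairing of a positive semidefinite matrix with a nonnegative quadratic form is
nonnegative. -/
theorem Matrix.PosSemidef.sum_mul_nonneg {ι : Type*} [Fintype ι] {A H : Matrix ι ι ℝ}
    (hA : A.PosSemidef) (hH : ∀ v : ι → ℝ, 0 ≤ ∑ i, ∑ j, v i * v j * H i j) :
    0 ≤ ∑ i, ∑ j, A i j * H i j := by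
  classical
  -- With `A = Bᵀ B` the pairing is the sum of the values of the quadratic form at the rows of `B`.
  obtain ⟨B, rfl⟩ := CStarAlgebra.nonneg_iff_eq_star_mul_self.mp hA.nonneg
  have : ∑ i, ∑ j, (star B * B) i j * H i j = ∑ k, ∑ i, ∑ j, B k i * B k j * H i j := by
    simp_rw [Matrix.mul_apply, Finset.sum_mul]
    rw [Finset.sum_comm (s := (Finset.univ : Finset ι)) (f := fun k i => ∑ j, B k i * B k j * H i j)]
    refine Finset.sum_congr rfl fun i _ => ?_
    rw [Finset.sum_comm]
    simp [Matrix.star_apply]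
  rw [this]
  exact Finset.sum_nonneg fun k _ => hH (B k)

namespace HypMin

/-! ### Quadratic test functions along a map -/

section LocalMin

variable {E V : Type*} [NormedAddCommGroup E] [NormedSpace ℝ E]
  [NormedAddCommGroup V] [InnerProductSpace ℝ V]

theorem inner_fderiv_eq_zero_of_isLocalMin {F : E → V} {u : E} (α : ℝ) (c : V)
    (hF : DifferentiableAt ℝ F u)
    (h : IsLocalMin (fun y => α * ‖F y‖ ^ 2 - 2 * ⟪F y, c⟫) u) (v : E) :
    ⟪α • F u - c, fderiv ℝ F u v⟫ = 0 := by
  have h1 := ((hF.hasFDerivAt.norm_sq.const_mul α).sub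
    ((hF.hasFDerivAt.inner ℝ (hasFDerivAt_const c u)).const_mul 2))
  have h2 := congrArg (fun L => L v) (h.hasFDerivAt_eq_zero h1)
  simp [real_inner_comm] at h2
  rw [inner_sub_left, inner_smul_left]
  simp
  linarith [real_inner_comm c (fderiv ℝ F u v)]

/-- Restricting to the line `u + t v` reduces this to one variable; the right-hand side is half the
second derivative there. -/
theorem hessian_nonneg_of_isLocalMin {F : E → V} {u : E} (α : ℝ) (c : V)
    (hF : ContDiffAt ℝ 2 F u)
    (h : IsLocalMin (fun y => α * ‖F y‖ ^ 2 - 2 * ⟪F y, c⟫) u) (v : E) :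
    0 ≤ α * ‖fderiv ℝ F u v‖ ^ 2 + ⟪α • F u - c, fderiv ℝ (fderiv ℝ F) u v v⟫ := by
  set l : ℝ → E := fun t => u + t • v with hl
  have hl0 : l 0 = u := by simp [hl]
  have hld : ∀ t, HasDerivAt l v t := fun t => by
    simpa [hl] using ((hasDerivAt_id t).smul_const v).const_add u
  have hlc : Tendsto l (𝓝 0) (𝓝 u) := by simpa [hl0] using (hld 0).continuousAt.tendsto
  have hd : ∀ᶠ y in 𝓝 u, DifferentiableAt ℝ F y := by
    filter_upwards [hF.eventually (by simp)] with y hy using hy.differentiableAt (by simp)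
  have hd2 : DifferentiableAt ℝ (fderiv ℝ F) u :=
    (hF.fderiv_right (m := 1) (by norm_num)).differentiableAt (by simp)
  have hFl : ∀ᶠ t in 𝓝 (0 : ℝ), HasDerivAt (fun t => F (l t)) (fderiv ℝ F (l t) v) t := by
    filter_upwards [hlc.eventually hd] with t ht
    exact ht.hasFDerivAt.comp_hasDerivAt t (hld t)
  have hφ : ∀ᶠ t in 𝓝 (0 : ℝ), HasDerivAt (fun t => α * ‖F (l t)‖ ^ 2 - 2 * ⟪F (l t), c⟫)
      (2 * ⟪α • F (l t) - c, fderiv ℝ F (l t) v⟫) t := by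
    filter_upwards [hFl] with t ht
    refine ((ht.norm_sq.const_mul α).sub
      ((ht.inner ℝ (hasDerivAt_const t c)).const_mul 2)).congr_deriv ?_
    rw [inner_sub_left, real_inner_smul_left, inner_zero_right,
      real_inner_comm c (fderiv ℝ F (l t) v)]
    ring
  have hmin : IsLocalMin (fun t => α * ‖F (l t)‖ ^ 2 - 2 * ⟪F (l t), c⟫) 0 := by
    have := hlc.eventually h
    simpa [IsLocalMin, IsMinFilter, hl0] using this
  have h2 := deriv_deriv_nonneg_of_isLocalMin hmin hφ.self_of_nhds.continuousAt
  have h3 : deriv (fun t => α * ‖F (l t)‖ ^ 2 - 2 * ⟪F (l t), c⟫) =ᶠ[𝓝 0]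
      fun t => 2 * ⟪α • F (l t) - c, fderiv ℝ F (l t) v⟫ := by
    filter_upwards [hφ] with t ht using ht.deriv
  rw [h3.deriv_eq] at h2
  have h4 : HasDerivAt (fun t => fderiv ℝ F (l t) v) (fderiv ℝ (fderiv ℝ F) u v v) 0 := by
    rw [← hl0] at hd2
    have := (hd2.hasFDerivAt.comp_hasDerivAt 0 (hld 0)).clm_apply (hasDerivAt_const 0 v)
    simpa [hl0] using this
  have h5 : HasDerivAt (fun t => 2 * ⟪α • F (l t) - c, fderiv ℝ F (l t) v⟫) _ 0 :=
    ((((hFl.self_of_nhds.const_smul α).sub_const c).inner ℝ h4).const_mul 2)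
  rw [h5.deriv] at h2
  simp [hl0, inner_smul_left] at h2
  linarith

end LocalMin

/-! ### Minimum principle in a parametrization -/

variable {m d : ℕ}

theorem partialD_partialD {F : Eucl m → Eucl d} {u : Eucl m} (hF : ContDiffAt ℝ 2 F u)
    (i j : Fin m) : partialD (partialD F j) i u =
      fderiv ℝ (fderiv ℝ F) u (EuclideanSpace.single i 1) (EuclideanSpace.single j 1) := by
  have hd2 : DifferentiableAt ℝ (fderiv ℝ F) u :=
    (hF.fderiv_right (m := 1) (by norm_num)).differentiableAt (by simp)
  have h := hd2.hasFDerivAt.clm_apply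
    (hasFDerivAt_const (EuclideanSpace.single j (1 : ℝ) : Eucl m) u)
  change fderiv ℝ (fun y => fderiv ℝ F y (EuclideanSpace.single j 1)) u _ = _
  rw [h.fderiv]
  simp

theorem sum_smul_single (v : Fin m → ℝ) :
    ∑ i, v i • (EuclideanSpace.single i (1 : ℝ) : Eucl m) = WithLp.toLp 2 v := by
  ext j
  simp [Finset.sum_apply, Pi.single_apply]

theorem firstForm_posDef {F : Eucl m → Eucl d} {u : Eucl m} (hx : ‖F u‖ < 1)
    (hinj : Function.Injective (fderiv ℝ F u)) : (firstForm F u).PosDef := by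
  have hpos : 0 < 1 - ‖F u‖ ^ 2 := by nlinarith [norm_nonneg (F u)]
  refine Matrix.PosDef.of_dotProduct_mulVec_pos ?_ ?_
  · ext i j
    simp [firstForm, hypMetric, real_inner_comm]
  · intro v hv
    have h1 : star v ⬝ᵥ (firstForm F u).mulVec v
        = 4 / (1 - ‖F u‖ ^ 2) ^ 2 * ‖fderiv ℝ F u (WithLp.toLp 2 v)‖ ^ 2 := by
      rw [← sum_smul_single v, map_sum, ← real_inner_self_eq_norm_sq (∑ _, _)]
      simp only [dotProduct, Matrix.mulVec, firstForm, Matrix.of_apply, hypMetric, partialD,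
        map_smul, sum_inner, inner_sum, inner_smul_left, inner_smul_right, Finset.mul_sum]
      refine Finset.sum_congr rfl fun i _ => Finset.sum_congr rfl fun j _ => ?_
      rw [real_inner_comm]
      simp
      ring
    rw [h1]
    have h2 : fderiv ℝ F u (WithLp.toLp 2 v) ≠ 0 := by
      rw [Ne, map_eq_zero_iff _ hinj]
      simpa using hv
    positivity

/-- A function that is a combination of the linear functions of the hyperboloid model has no
negative local minimum along a parametrized piece with vanishing mean curvature. -/
theorem no_negative_localMin_of_meanCurvature_eq_zero (hm : 1 ≤ m) {F : Eucl m → Eucl d}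
    {u : Eucl m} (hF : ContDiffAt ℝ 2 F u) (hinj : Function.Injective (fderiv ℝ F u))
    (hx : ‖F u‖ < 1) (hH : meanCurvature F u = 0) {l : ℝ} (hl : l < 0) (c : Eucl d)
    (h0 : (1 + l) * ‖F u‖ ^ 2 + (1 - l) - 2 * ⟪F u, c⟫ = 0) :
    ¬ IsLocalMin (fun y => (1 + l) * ‖F y‖ ^ 2 - 2 * ⟪F y, c⟫) u := by
  -- The test function is `g - l (1 - ‖y‖²)` without its constant term `1 - l`, so a local minimum
  -- of `g / (1 - ‖y‖²)` with value `l` is handled without differentiating a quotient. `N` is half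
  -- its Euclidean gradient and `H` below half its Hessian along `F`.
  intro hmin
  set x := F u with hxdef
  set N := (1 + l) • x - c with hN
  have hpos : 0 < 1 - ‖x‖ ^ 2 := by nlinarith [norm_nonneg x]
  have hg := firstForm_posDef hx hinj
  have hgrad := inner_fderiv_eq_zero_of_isLocalMin (1 + l) c (hF.differentiableAt (by simp)) hmin
  have hhess := hessian_nonneg_of_isLocalMin (1 + l) c hF hmin
  set H : Matrix (Fin m) (Fin m) ℝ := Matrix.of fun i j =>
    (1 + l) * ⟪partialD F i u, partialD F j u⟫ + ⟪N, partialD (partialD F j) i u⟫ with hHdef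
  have hHnonneg : ∀ v : Fin m → ℝ, 0 ≤ ∑ i, ∑ j, v i * v j * H i j := by
    intro v
    refine (hhess (WithLp.toLp 2 v)).trans_eq ?_
    rw [← sum_smul_single v, ← real_inner_self_eq_norm_sq]
    simp only [hHdef, Matrix.of_apply, partialD_partialD hF]
    simp only [partialD, map_sum, map_smul,
      sum_apply, smul_apply, sum_inner, inner_sum,
      inner_smul_left, inner_smul_right, Finset.mul_sum, ← Finset.sum_add_distrib]
    rw [Finset.sum_comm]
    refine Finset.sum_congr rfl fun i _ => Finset.sum_congr rfl fun j _ => ?_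
    simp [hN]
    ring
  have hsum := hg.inv.posSemidef.sum_mul_nonneg hHnonneg
  have hNt : N ∈ (paramTangent F u)ᗮ := by
    rw [Submodule.mem_orthogonal']
    rintro _ ⟨v, rfl⟩
    exact hgrad v
  have hH0 : ∑ i, ∑ j, (firstForm F u)⁻¹ i j *
      ⟪N, partialD (partialD F j) i u + christoffel x (partialD F i u) (partialD F j u)⟫ = 0 := by
    have h := congrArg (fun y => ⟪N, y⟫) hH
    simp only [meanCurvature, inner_sum, inner_smul_right, inner_zero_right] at h
    rw [← h]
    refine Finset.sum_congr rfl fun i _ => Finset.sum_congr rfl fun j _ => ?_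
    rw [secondForm, ← Submodule.inner_starProjection_left_eq_right,
      Submodule.starProjection_eq_self_iff.mpr hNt]
  -- Since `N` is normal, only the `-⟪v, w⟫ x` term of the Christoffel symbols survives, and `h0`
  -- evaluates it. Tracing with the inverse metric kills the first summand and leaves `m l (1 -
  -- ‖x‖²) / 2 < 0`.
  have hentry : ∀ i j, H i j =
      ⟪N, partialD (partialD F j) i u + christoffel x (partialD F i u) (partialD F j u)⟫
        + l * (1 - ‖x‖ ^ 2) / 2 * firstForm F u i j := by
    intro i j
    have hi : ⟪N, partialD F i u⟫ = 0 := hgrad _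
    have hj : ⟪N, partialD F j u⟫ = 0 := hgrad _
    have hNx : ⟪N, x⟫ = (1 + l) * ‖x‖ ^ 2 - ⟪x, c⟫ := by
      rw [hN, inner_sub_left, inner_smul_left, real_inner_self_eq_norm_sq, real_inner_comm]
      simp
    simp only [hHdef, Matrix.of_apply, christoffel, inner_add_right, inner_smul_right,
      inner_sub_right, hi, hj, hNx, firstForm, hypMetric, ← hxdef]
    field_simp
    linear_combination (2 * ⟪partialD F i u, partialD F j u⟫) * h0
  have htr : ∑ i, ∑ j, (firstForm F u)⁻¹ i j * firstForm F u i j = m := by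
    have h1 : (firstForm F u)⁻¹ * firstForm F u = 1 :=
      Matrix.nonsing_inv_mul _ ((Matrix.isUnit_iff_isUnit_det _).mp hg.isUnit)
    have h2 := congrArg Matrix.trace h1
    rw [Matrix.trace_one, Fintype.card_fin] at h2
    rw [← h2]
    simp only [Matrix.trace, Matrix.diag, Matrix.mul_apply]
    refine Finset.sum_congr rfl fun i _ => Finset.sum_congr rfl fun j _ => ?_
    congr 1
    simp [firstForm, hypMetric, real_inner_comm]
  simp only [hentry, mul_add, Finset.sum_add_distrib, hH0, zero_add] at hsum
  have h6 : ∑ i, ∑ j, (firstForm F u)⁻¹ i j * (l * (1 - ‖x‖ ^ 2) / 2 * firstForm F u i j)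
      = l * (1 - ‖x‖ ^ 2) / 2 * m := by
    rw [← htr]
    simp only [Finset.mul_sum]
    refine Finset.sum_congr rfl fun i _ => Finset.sum_congr rfl fun j _ => ?_
    ring
  rw [h6] at hsum
  have hm' : (0 : ℝ) < m := by exact_mod_cast hm
  have : l * (1 - ‖x‖ ^ 2) / 2 * m < 0 := by
    have := mul_pos hpos hm'
    nlinarith
  linarith

end HypMin

/-! ### Tangent cones and charts -/

theorem HasDerivAt.mem_posTangentConeAt {E : Type*} [NormedAddCommGroup E] [NormedSpace ℝ E]
    {γ : ℝ → E} {v x : E} {s : Set E} (hγ : HasDerivAt γ v 0) (h0 : γ 0 = x)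
    (hs : ∀ᶠ t in 𝓝[>] 0, γ t ∈ s) : v ∈ posTangentConeAt s x := by
  refine mem_tangentConeAt_of_seq (𝓝[>] (0 : ℝ)) (fun t => Real.toNNReal t⁻¹)
    (fun t => γ t - x) ?_ ?_ ?_
  · have h1 := hγ.continuousAt.tendsto.mono_left (nhdsWithin_le_nhds (s := Set.Ioi 0))
    simpa [h0] using h1.sub_const x
  · simpa using hs
  · have h1 := hγ.tendsto_slope_zero_right
    refine h1.congr' ?_
    filter_upwards [self_mem_nhdsWithin] with t ht
    have ht' : 0 ≤ t⁻¹ := inv_nonneg.mpr (le_of_lt ht)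
    rw [NNReal.smul_def, Real.coe_toNNReal _ ht', zero_add, h0]

namespace OpenPartialHomeomorph

variable {E F : Type*} [NormedAddCommGroup E] [NormedSpace ℝ E] [NormedAddCommGroup F]
  [NormedSpace ℝ F]

theorem fderiv_symm_injective (Φ : OpenPartialHomeomorph E F) {b : F} (hb : b ∈ Φ.target)
    (h : DifferentiableAt ℝ Φ (Φ.symm b)) (h' : DifferentiableAt ℝ Φ.symm b) :
    Function.Injective (fderiv ℝ Φ.symm b) := by
  have h1 := h.hasFDerivAt.comp b h'.hasFDerivAt
  have h2 : (Φ ∘ Φ.symm) =ᶠ[𝓝 b] id := by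
    filter_upwards [Φ.open_target.mem_nhds hb] with y hy using Φ.right_inv hy
  have h3 := h1.unique ((hasFDerivAt_id b).congr_of_eventuallyEq h2)
  intro v w hvw
  have h4 := fun v => congrArg (fun L => L v) h3
  simp only [ContinuousLinearMap.comp_apply, ContinuousLinearMap.id_apply] at h4
  rw [← h4 v, ← h4 w, hvw]

end OpenPartialHomeomorph

/-! ### Minimum principle on a submanifold -/

namespace HypMin

variable {n m : ℕ}

/-- The coordinate subspace `ℝ^m` of `ℝ^(n+1)` spanned by the half-space model. -/
def coordSubspace (n m : ℕ) : Submodule ℝ (Eucl (n + 1)) where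
  carrier := {z | ∀ i : Fin (n + 1), m ≤ i.val → z i = 0}
  add_mem' := fun {a b} ha hb i hi => by simp [ha i hi, hb i hi]
  zero_mem' := fun i _ => by simp
  smul_mem' := fun c a ha i hi => by simp [ha i hi]

theorem mem_coordSubspace {z : Eucl (n + 1)} :
    z ∈ coordSubspace n m ↔ ∀ i : Fin (n + 1), m ≤ i.val → z i = 0 := Iff.rfl

theorem mem_halfSpace_iff {z : Eucl (n + 1)} :
    z ∈ halfSpace n m ↔ 0 ≤ z 0 ∧ z ∈ coordSubspace n m := Iff.rfl

/-- The inclusion of `ℝ^m` in `ℝ^(n+1)` as the first `m` coordinates. -/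
noncomputable def coordIncl (n m : ℕ) : Eucl m →L[ℝ] Eucl (n + 1) :=
  LinearMap.toContinuousLinearMap
    { toFun := fun u => WithLp.toLp 2 fun i => if h : i.val < m then u ⟨i.val, h⟩ else 0
      map_add' := fun u v => by
        ext i
        by_cases h : i.val < m <;> simp [h]
      map_smul' := fun c u => by
        ext i
        by_cases h : i.val < m <;> simp [h] }

theorem coordIncl_apply (u : Eucl m) (i : Fin (n + 1)) :
    coordIncl n m u i = if h : i.val < m then u ⟨i.val, h⟩ else 0 := rfl

theorem coordIncl_mem (u : Eucl m) : coordIncl n m u ∈ coordSubspace n m := fun i hi => by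
  simp [coordIncl_apply, not_lt.mpr hi]

theorem coordIncl_injective (hmn : m ≤ n + 1) : Function.Injective (coordIncl n m) := by
  intro u v h
  ext i
  have := congrArg (fun z : Eucl (n + 1) => z (Fin.castLE hmn i)) h
  simpa [coordIncl_apply] using this

theorem exists_coordIncl_eq (hmn : m ≤ n + 1) {z : Eucl (n + 1)} (hz : z ∈ coordSubspace n m) :
    ∃ u, coordIncl n m u = z := by
  refine ⟨WithLp.toLp 2 fun i => z (Fin.castLE hmn i), ?_⟩
  ext i
  rw [coordIncl_apply]
  split_ifs with h
  · rfl
  · exact (hz i (not_lt.mp h)).symm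

/-- On a minimal submanifold, a combination of the linear functions of the hyperboloid model has no
negative local minimum. -/
theorem IsMinimal.no_negative_localMin (hm : 1 ≤ m) (hmn : m ≤ n + 1) {S : Set (Eucl (n + 1))}
    (hS_ball : S ⊆ Metric.ball 0 1) (hS_sub : IsSubmanifoldWithBoundary 2 m S ∅)
    (hS_min : IsMinimal m S) {x : Eucl (n + 1)} (hx : x ∈ S) {l : ℝ} (hl : l < 0)
    (c : Eucl (n + 1)) (h0 : (1 + l) * ‖x‖ ^ 2 + (1 - l) - 2 * ⟪x, c⟫ = 0)
    (hmin : ∀ᶠ y in 𝓝 x, y ∈ S → 0 ≤ (1 + l) * ‖y‖ ^ 2 + (1 - l) - 2 * ⟪y, c⟫) : False := by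
  obtain ⟨Φ, hxs, hΦ, hΨ, hM, hB⟩ := hS_sub.2 x hx
  have hxh := mem_halfSpace_iff.mp ((hM x hxs).mp hx)
  -- The boundary is empty, so the chart cannot send `x` to the face `z₀ = 0`; this leaves an open
  -- set of parameters around it.
  have hxpos : 0 < Φ x 0 := by
    refine lt_of_le_of_ne hxh.1 fun h => ?_
    exact (hB x hxs).mpr ⟨mem_halfSpace_iff.mpr hxh, h.symm⟩
  obtain ⟨u₀, hu₀⟩ := exists_coordIncl_eq hmn hxh.2
  set ι := coordIncl n m with hι
  set F : Eucl m → Eucl (n + 1) := fun u => Φ.symm (ι u) with hF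
  set U : Set (Eucl m) := ι ⁻¹' (Φ.target ∩ {z | 0 < z 0}) with hU
  have hc0 : Continuous fun z : Eucl (n + 1) => z 0 := by fun_prop
  have hUo : IsOpen U :=
    (Φ.open_target.inter (isOpen_lt continuous_const hc0)).preimage ι.continuous
  have hu₀U : u₀ ∈ U := by
    refine ⟨?_, ?_⟩
    · rw [hu₀]
      exact Φ.map_source hxs
    · simpa [hu₀] using hxpos
  have hΨat : ∀ u ∈ U, ContDiffAt ℝ 2 Φ.symm (ι u) := fun u hu =>
    hΨ.contDiffAt (Φ.open_target.mem_nhds hu.1)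
  have hFat : ∀ u ∈ U, ContDiffAt ℝ 2 F u := fun u hu =>
    (hΨat u hu).comp u ι.contDiff.contDiffAt
  have hparam : IsLocalParam F U S := by
    refine ⟨hUo, fun u hu => (hFat u hu).contDiffWithinAt, fun u hu => ?_, fun u hu => ?_⟩
    · have hd := (hΨat u hu).differentiableAt (by simp)
      have h1 : fderiv ℝ F u = (fderiv ℝ Φ.symm (ι u)).comp ι :=
        (hd.hasFDerivAt.comp u ι.hasFDerivAt).fderiv
      rw [h1, ContinuousLinearMap.coe_comp]
      refine Function.Injective.comp (Φ.fderiv_symm_injective hu.1 ?_ hd)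
        (coordIncl_injective hmn)
      exact (hΦ.contDiffAt (Φ.open_source.mem_nhds (Φ.map_target hu.1))).differentiableAt (by simp)
    · refine (hM _ (Φ.map_target hu.1)).mpr ?_
      rw [Φ.right_inv hu.1]
      exact ⟨le_of_lt hu.2, coordIncl_mem u⟩
  have hFu₀ : F u₀ = x := by
    rw [hF]
    simp only [hu₀]
    exact Φ.left_inv hxs
  have hxn : ‖F u₀‖ < 1 := by
    rw [hFu₀]
    simpa using hS_ball hx
  refine no_negative_localMin_of_meanCurvature_eq_zero hm (hFat u₀ hu₀U)
    (hparam.immersion u₀ hu₀U) hxn (hS_min F U hparam u₀ hu₀U) hl c (by rw [hFu₀]; exact h0) ?_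
  have hFc : Tendsto F (𝓝 u₀) (𝓝 x) := by
    have := (hFat u₀ hu₀U).continuousAt.tendsto
    rwa [hFu₀] at this
  filter_upwards [hFc.eventually hmin, hUo.mem_nhds hu₀U] with u hu huU
  have := hu (hparam.mapsTo huU)
  rw [hFu₀]
  linarith

/-! ### Barriers by totally geodesic spheres -/

section Barrier

variable {E V : Type*} [NormedAddCommGroup E] [NormedSpace ℝ E] [FiniteDimensional ℝ E]
  [NormedAddCommGroup V] [InnerProductSpace ℝ V]

theorem abs_norm_add_sq_sub_le {v e : V} {C η : ℝ} (hv : ‖v‖ ≤ C) (he : ‖e‖ ≤ η) (hη : η ≤ 1) :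
    |‖v + e‖ ^ 2 - ‖v‖ ^ 2| ≤ (2 * C + 1) * η := by
  have h1 : ‖v + e‖ ^ 2 - ‖v‖ ^ 2 = 2 * ⟪v, e⟫ + ‖e‖ ^ 2 := by
    rw [norm_add_sq_real]
    ring
  have h2 : |⟪v, e⟫| ≤ C * η := (abs_real_inner_le_norm v e).trans
    (mul_le_mul hv he (norm_nonneg _) ((norm_nonneg v).trans hv))
  have h3 := norm_nonneg e
  rw [h1, abs_le]
  rw [abs_le] at h2
  constructor <;> nlinarith

/-- If the image of `W` under the derivative of a map `Ψ` with `Ψ b = p` does not contain the unit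
vector `p`, then small totally geodesic spheres separate `Ψ (b + t e)` from
`{Ψ (b + t k) : k ∈ W, ‖k - e‖ = r}`. -/
theorem eventually_exists_barrier {Ψ : E → V} {A : E →L[ℝ] V} {b e : E} {p : V}
    (hΨ : HasFDerivAt Ψ A b) (hb : Ψ b = p) (hp : ‖p‖ = 1) (hA : Function.Injective A)
    (W : Submodule ℝ E) (heW : e ∈ W) (hpW : p ∉ W.map A.toLinearMap) {r : ℝ} (hr : 0 < r) :
    ∀ᶠ t : ℝ in 𝓝[>] 0, ∃ c : V,
      ‖Ψ (b + t • e)‖ ^ 2 + 1 - 2 * ⟪Ψ (b + t • e), c⟫ < 0 ∧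
      ∀ k ∈ W, ‖k - e‖ = r → 0 < ‖Ψ (b + t • k)‖ ^ 2 + 1 - 2 * ⟪Ψ (b + t • k), c⟫ := by
  set T := W.map A.toLinearMap with hT
  have hAT : ∀ k ∈ W, A k ∈ T := fun k hk => Submodule.mem_map_of_mem hk
  obtain ⟨n₀, hn₀T, hn₀p⟩ : ∃ n₀ ∈ Tᗮ, ⟪n₀, p⟫ ≠ 0 := by
    by_contra! h
    refine hpW ?_
    rw [← Submodule.orthogonal_orthogonal T, Submodule.mem_orthogonal]
    exact h
  -- The rescaled centre: moving from `A e` along the normal `n₀` of `T` until it is orthogonal to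
  -- `p`. Thus `A e` is the point of `T` nearest to `a₀`.
  set a₀ : V := A e - (⟪A e, p⟫ / ⟪n₀, p⟫) • n₀ with ha₀
  have ha₀p : ⟪a₀, p⟫ = 0 := by
    rw [ha₀, inner_sub_left, real_inner_smul_left]
    field_simp
    simp
  have hea : A e - a₀ ∈ Tᗮ := by
    rw [ha₀, sub_sub_cancel]
    exact Tᗮ.smul_mem _ hn₀T
  obtain ⟨K, hK, hKA⟩ := A.toLinearMap.exists_antilipschitzWith (LinearMap.ker_eq_bot.mpr hA)
  have hKA' : ∀ y, ‖y‖ ≤ K * ‖A y‖ := fun y => by simpa using hKA.le_mul_norm_sub y 0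
  have hK' : (0 : ℝ) < K := hK
  -- On the rim `‖A k - a₀‖²` exceeds its value at `e` by at least `(r / K)²`. The squared radius
  -- `R2` lies half of this above the value at `e`, leaving a margin `δ` on both sides.
  set δ : ℝ := (r / K) ^ 2 / 2 with hδ
  have hδpos : 0 < δ := by positivity
  set R2 : ℝ := ‖A e - a₀‖ ^ 2 + δ with hR2
  -- Gives the limit sphere squared radius `R2`: the centre `c` below has `‖c‖² - 1 = t² R2` up to
  -- higher order in `t`.
  set β : ℝ := (R2 - ‖a₀‖ ^ 2) / 2 with hβ
  set B : ℝ := ‖e‖ + r with hB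
  have hBpos : 0 < B := by positivity
  set C : ℝ := ‖A‖ * B + ‖a₀‖ with hC
  have hCnn : 0 ≤ C := by positivity
  set η : ℝ := min 1 (δ / (3 * (2 * C + 1))) with hη
  have hηpos : 0 < η := by positivity
  have hη1 : η ≤ 1 := min_le_left _ _
  have hηδ : (2 * C + 1) * η ≤ δ / 3 := by
    have h1 : η ≤ δ / (3 * (2 * C + 1)) := min_le_right _ _
    calc (2 * C + 1) * η ≤ (2 * C + 1) * (δ / (3 * (2 * C + 1))) := by gcongr
      _ = δ / 3 := by field_simp
  obtain ⟨ρ, hρ, hlin⟩ : ∃ ρ > 0, ∀ h : E, ‖h‖ < ρ → ‖Ψ (b + h) - p - A h‖ ≤ η / B * ‖h‖ := by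
    have h1 := (hasFDerivAt_iff_isLittleO_nhds_zero.mp hΨ).def (show 0 < η / B by positivity)
    obtain ⟨ρ, hρ, h2⟩ := Metric.eventually_nhds_iff.mp h1
    refine ⟨ρ, hρ, fun h hh => ?_⟩
    have := h2 (y := h) (by simpa using hh)
    rwa [hb] at this
  have ht1 : ∀ᶠ t : ℝ in 𝓝[>] 0, t * B < ρ := by
    have : Tendsto (fun t : ℝ => t * B) (𝓝[>] 0) (𝓝 0) := by
      have h : Tendsto (fun t : ℝ => t * B) (𝓝 0) (𝓝 (0 * B)) := tendsto_id.mul_const B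
      rw [zero_mul] at h
      exact h.mono_left nhdsWithin_le_nhds
    exact this.eventually_lt_const hρ
  have ht2 : ∀ᶠ t : ℝ in 𝓝[>] 0, t * (2 * |β| * (C + 1)) < δ / 3 := by
    have : Tendsto (fun t : ℝ => t * (2 * |β| * (C + 1))) (𝓝[>] 0) (𝓝 0) := by
      have h : Tendsto (fun t : ℝ => t * (2 * |β| * (C + 1))) (𝓝 0)
        (𝓝 (0 * (2 * |β| * (C + 1)))) := tendsto_id.mul_const _
      rw [zero_mul] at h
      exact h.mono_left nhdsWithin_le_nhds
    exact this.eventually_lt_const (by positivity)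
  filter_upwards [ht1, ht2, self_mem_nhdsWithin] with t ht1 ht2 ht
  replace ht : 0 < t := ht
  -- The terms of order 0 and 1 in `t` cancel because `‖p‖ = 1` and `a₀ ⊥ p`. The error `θ` has two
  -- parts, from the linearization of `Ψ` and from the `β` correction, each at most `δ / 3`.
  have key : ∀ k, ‖k - e‖ ≤ r → ∃ θ : ℝ, |θ| < δ ∧
      ‖Ψ (b + t • k)‖ ^ 2 + 1 - 2 * ⟪Ψ (b + t • k), p + t • a₀ + (t ^ 2 * β) • p⟫
        = t ^ 2 * (‖A k - a₀‖ ^ 2 - R2 + θ) := by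
    intro k hk
    have hkB : ‖k‖ ≤ B := by
      calc ‖k‖ = ‖e + (k - e)‖ := by simp
        _ ≤ ‖e‖ + ‖k - e‖ := norm_add_le _ _
        _ ≤ B := by rw [hB]; gcongr
    set s : V := t⁻¹ • (Ψ (b + t • k) - p - A (t • k)) with hs
    have hsη : ‖s‖ ≤ η := by
      have htk : ‖t • k‖ ≤ t * B := by
        rw [norm_smul, Real.norm_of_nonneg ht.le]
        gcongr
      have h1 := hlin (t • k) (htk.trans_lt ht1)
      rw [hs, norm_smul, norm_inv, Real.norm_of_nonneg ht.le]
      calc t⁻¹ * ‖Ψ (b + t • k) - p - A (t • k)‖ ≤ t⁻¹ * (η / B * (t * B)) := by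
            gcongr
            exact h1.trans (by gcongr)
        _ = η := by field_simp
    have hX : Ψ (b + t • k) = p + t • (A k + s) := by
      rw [smul_add, hs, smul_inv_smul₀ ht.ne', map_smul]
      abel
    have hAk : ‖A k‖ ≤ ‖A‖ * B := (A.le_opNorm k).trans (by gcongr)
    have hAkC : ‖A k - a₀‖ ≤ C := (norm_sub_le _ _).trans (by rw [hC]; gcongr)
    have h1 := abs_norm_add_sq_sub_le hAkC hsη hη1
    have hY : ‖A k + s‖ ≤ C + 1 := by
      refine (norm_add_le _ _).trans ?_
      have := norm_nonneg a₀
      linarith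
    have h2 : |⟪p, A k + s⟫| ≤ C + 1 := by
      refine (abs_real_inner_le_norm _ _).trans ?_
      rw [hp, one_mul]
      exact hY
    have h3 : |2 * t * β * ⟪p, A k + s⟫| ≤ t * (2 * |β| * (C + 1)) := by
      rw [abs_mul, abs_mul, abs_mul, abs_two, abs_of_pos ht]
      calc 2 * t * |β| * |⟪p, A k + s⟫| ≤ 2 * t * |β| * (C + 1) := by gcongr
        _ = _ := by ring
    refine ⟨(‖A k - a₀ + s‖ ^ 2 - ‖A k - a₀‖ ^ 2) - 2 * t * β * ⟪p, A k + s⟫, ?_, ?_⟩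
    · refine (abs_sub _ _).trans_lt ?_
      linarith
    · have hY0 : A k - a₀ + s = (A k + s) - a₀ := by abel
      rw [hX, hY0]
      generalize A k + s = Y
      have hpp : ⟪p, p⟫ = 1 := by rw [real_inner_self_eq_norm_sq, hp, one_pow]
      rw [norm_add_sq_real, norm_sub_sq_real Y a₀, hp]
      simp only [inner_add_left, inner_add_right, real_inner_smul_left, real_inner_smul_right,
        norm_smul, hpp, real_inner_comm p a₀ ▸ ha₀p, real_inner_comm Y p, mul_pow,
        Real.norm_eq_abs, sq_abs]
      rw [hβ]
      ring
  refine ⟨p + t • a₀ + (t ^ 2 * β) • p, ?_, fun k hk hkr => ?_⟩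
  · obtain ⟨θ, hθ, h⟩ := key e (by simpa using hr.le)
    rw [h]
    rw [abs_lt] at hθ
    refine mul_neg_of_pos_of_neg (by positivity) ?_
    rw [hR2]
    linarith
  · obtain ⟨θ, hθ, h⟩ := key k hkr.le
    rw [h]
    rw [abs_lt] at hθ
    refine mul_pos (by positivity) ?_
    -- Pythagoras: the first summand lies in `T`, the second in `Tᗮ`.
    have h1 : A k - a₀ = A (k - e) + (A e - a₀) := by
      rw [map_sub]
      abel
    have h2 : ⟪A (k - e), A e - a₀⟫ = 0 :=
      (Submodule.mem_orthogonal _ _).mp hea _ (hAT _ (W.sub_mem hk heW))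
    have h3 : (r / K) ^ 2 ≤ ‖A (k - e)‖ ^ 2 := by
      have := hKA' (k - e)
      rw [hkr] at this
      gcongr
      rwa [div_le_iff₀' hK']
    rw [h1, norm_add_sq_real, h2, hR2]
    linarith [hδ]

end Barrier

end HypMin

/-! ### Tangent spaces at the boundary and the contradiction -/

namespace HypMin

variable {n m : ℕ}

/-- Projecting the line `p + t w` radially to the sphere shows that each `w ⊥ p` is tangent; take
for `w` the part of `v` orthogonal to `p`. -/
theorem tangentSpaceAt_sphere_orthogonal_le {d : ℕ} {p : Eucl d} (hp : ‖p‖ = 1) :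
    (tangentSpaceAt (Metric.sphere 0 1) p)ᗮ ≤ Submodule.span ℝ {p} := by
  intro v hv
  have hpp : ⟪p, p⟫ = 1 := by rw [real_inner_self_eq_norm_sq, hp, one_pow]
  set w := v - ⟪v, p⟫ • p with hw
  have hwp : ⟪p, w⟫ = 0 := by
    rw [hw, inner_sub_right, real_inner_smul_right, hpp, real_inner_comm, mul_one, sub_self]
  have hnorm : ∀ t : ℝ, 0 < ‖p + t • w‖ := fun t => by
    refine norm_pos_iff.mpr fun h => ?_
    have := congrArg (fun y => ⟪p, y⟫) h
    simp [inner_add_right, real_inner_smul_right, hwp, hp] at this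
  have hl : HasDerivAt (fun t : ℝ => p + t • w) w 0 := by
    simpa using ((hasDerivAt_id (0 : ℝ)).smul_const w).const_add p
  have hsq : HasDerivAt (fun t : ℝ => ‖p + t • w‖ ^ 2) 0 0 := by
    simpa [hwp] using hl.norm_sq
  have hinv : HasDerivAt (fun t : ℝ => (√(‖p + t • w‖ ^ 2))⁻¹) 0 0 := by
    simpa [hp] using (hsq.sqrt (by simp [hp])).fun_inv (by simp [hp])
  have hγ : HasDerivAt (fun t : ℝ => (√(‖p + t • w‖ ^ 2))⁻¹ • (p + t • w)) w 0 := by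
    refine (hinv.smul hl).congr_deriv ?_
    simp [hp]
  have hcone : w ∈ posTangentConeAt (Metric.sphere 0 1) p := by
    refine hγ.mem_posTangentConeAt (by simp [hp]) (Eventually.of_forall fun t => ?_)
    rw [mem_sphere_zero_iff_norm, norm_smul, Real.sqrt_sq (norm_nonneg _), norm_inv, norm_norm,
      inv_mul_cancel₀ (hnorm t).ne']
  have hvw : ⟪w, v⟫ = 0 := (Submodule.mem_orthogonal _ _).mp hv _ (Submodule.subset_span hcone)
  have hv' : v = w + ⟪v, p⟫ • p := by rw [hw, sub_add_cancel]
  have hww : ⟪w, w⟫ = 0 := by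
    rwa [hv', inner_add_right, real_inner_smul_right, real_inner_comm p w, hwp, mul_zero,
      add_zero] at hvw
  rw [inner_self_eq_zero] at hww
  rw [hv', hww, zero_add]
  exact Submodule.smul_mem _ _ (Submodule.mem_span_singleton_self p)

/-- The derivative of a straightening chart identifies the coordinate subspace with a subspace of
the tangent space at a boundary point. -/
theorem map_coordSubspace_le_tangentSpaceAt {M : Set (Eucl (n + 1))}
    (Φ : OpenPartialHomeomorph (Eucl (n + 1)) (Eucl (n + 1))) {p : Eucl (n + 1)}
    (hp : p ∈ Φ.source) (hd : DifferentiableAt ℝ Φ.symm (Φ p))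
    (hM : ∀ x ∈ Φ.source, x ∈ M ↔ Φ x ∈ halfSpace n m) (hpM : p ∈ M) :
    (coordSubspace n m).map (fderiv ℝ Φ.symm (Φ p)).toLinearMap ≤ tangentSpaceAt M p := by
  have hph := mem_halfSpace_iff.mp ((hM p hp).mp hpM)
  have key : ∀ w ∈ coordSubspace n m, 0 ≤ w 0 →
      fderiv ℝ Φ.symm (Φ p) w ∈ tangentSpaceAt M p := by
    intro w hw hw0
    refine Submodule.subset_span ?_
    have hl : HasDerivAt (fun t : ℝ => Φ p + t • w) w 0 := by
      simpa using ((hasDerivAt_id (0 : ℝ)).smul_const w).const_add (Φ p)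
    have hl0 : Φ p + (0 : ℝ) • w = Φ p := by simp
    have hγ : HasDerivAt (fun t : ℝ => Φ.symm (Φ p + t • w)) (fderiv ℝ Φ.symm (Φ p) w) 0 := by
      have h := hd.hasFDerivAt
      rw [← hl0] at h
      exact (h.comp_hasDerivAt (0 : ℝ) hl).congr_deriv (by rw [hl0])
    refine hγ.mem_posTangentConeAt (by simp [Φ.left_inv hp]) ?_
    have htarget : ∀ᶠ t : ℝ in 𝓝[>] 0, Φ p + t • w ∈ Φ.target := by
      refine nhdsWithin_le_nhds (hl.continuousAt.eventually_mem ?_)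
      rw [hl0]
      exact Φ.open_target.mem_nhds (Φ.map_source hp)
    filter_upwards [htarget, self_mem_nhdsWithin] with t ht ht0
    replace ht0 : 0 < t := ht0
    rw [hM _ (Φ.map_target ht), Φ.right_inv ht, mem_halfSpace_iff]
    refine ⟨?_, Submodule.add_mem _ hph.2 (Submodule.smul_mem _ _ hw)⟩
    have := hph.1
    simp only [PiLp.add_apply, PiLp.smul_apply, smul_eq_mul]
    positivity
  rintro _ ⟨w, hw, rfl⟩
  rcases le_total 0 (w 0) with h | h
  · exact key w hw h
  · have h1 := key (-w) (Submodule.neg_mem _ hw) (by simpa using h)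
    rw [map_neg, Submodule.neg_mem_iff] at h1
    exact h1

/-- The image of the coordinate subspace under the derivative of a boundary chart contains the
normal of the sphere. -/
theorem mem_map_coordSubspace (hm : 1 ≤ m) (hmn : m ≤ n + 1)
    {S Γ : Set (Eucl (n + 1))}
    (hS_ball : S ⊆ Metric.ball 0 1) (hΓ_sphere : Γ ⊆ Metric.sphere 0 1)
    (hS_sub : IsSubmanifoldWithBoundary 2 m S ∅) (hS_min : IsMinimal m S)
    (Φ : OpenPartialHomeomorph (Eucl (n + 1)) (Eucl (n + 1))) {p : Eucl (n + 1)} (hpΓ : p ∈ Γ)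
    (hp : p ∈ Φ.source) (hΦ : DifferentiableAt ℝ Φ p) (hΨ : DifferentiableAt ℝ Φ.symm (Φ p))
    (hM : ∀ x ∈ Φ.source, x ∈ S ∪ Γ ↔ Φ x ∈ halfSpace n m)
    (hB : ∀ x ∈ Φ.source, x ∈ Γ ↔ Φ x ∈ halfSpace n m ∧ Φ x 0 = 0) :
    p ∈ (coordSubspace n m).map (fderiv ℝ Φ.symm (Φ p)).toLinearMap := by
  by_contra hpT
  set W := coordSubspace n m with hW
  set b := Φ p with hb
  have hbt : b ∈ Φ.target := Φ.map_source hp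
  have hbp : Φ.symm b = p := Φ.left_inv hp
  obtain ⟨hbh, hb0⟩ := (hB p hp).mp hpΓ
  have hbW : b ∈ W := (mem_halfSpace_iff.mp hbh).2
  have hp1 : ‖p‖ = 1 := by simpa using hΓ_sphere hpΓ
  set e : Eucl (n + 1) := EuclideanSpace.single 0 1 with he
  have heW : e ∈ W := fun i hi => by
    have : i ≠ 0 := fun h => by simp [h] at hi; omega
    simp [he, this]
  have hA := Φ.fderiv_symm_injective hbt (by rwa [hbp]) hΨ
  -- Any radius below 1 would do: it keeps `k 0 > 0` on the disk around `e`, so the piece avoids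
  -- `Γ`.
  have hbar := eventually_exists_barrier hΨ.hasFDerivAt hbp hp1 hA W heW hpT
    (show (0 : ℝ) < 1 / 2 by norm_num)
  set D : Set (Eucl (n + 1)) := Metric.closedBall e (1 / 2) ∩ W with hD
  have hDc : IsCompact D :=
    (isCompact_closedBall e (1 / 2)).inter_right W.closed_of_finiteDimensional
  have htarget : ∀ᶠ t : ℝ in 𝓝[>] 0, ∀ k ∈ D, b + t • k ∈ Φ.target := by
    refine nhdsWithin_le_nhds (hDc.eventually_forall_of_forall_eventually fun k _ => ?_)
    have hc : Continuous fun z : ℝ × Eucl (n + 1) => b + z.1 • z.2 := by fun_prop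
    refine hc.continuousAt.eventually_mem (Φ.open_target.mem_nhds ?_)
    simpa using hbt
  obtain ⟨t, ⟨⟨c, hce, hcr⟩, htt⟩, ht⟩ := ((hbar.and htarget).and self_mem_nhdsWithin).exists
  replace ht : 0 < t := ht
  have hDS : ∀ k ∈ D, Φ.symm (b + t • k) ∈ S := by
    intro k hk
    have hk0 : 0 < (b + t • k) 0 := by
      have h1 := PiLp.norm_apply_le (k - e) 0
      have h2 : ‖k - e‖ ≤ 1 / 2 := by simpa [dist_eq_norm] using hk.1
      have h3 : (k - e) 0 = k 0 - 1 := by simp [he]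
      rw [h3, Real.norm_eq_abs] at h1
      have h4 := (abs_le.mp (h1.trans h2)).1
      have h5 : 0 < k 0 := by linarith
      simp only [PiLp.add_apply, PiLp.smul_apply, smul_eq_mul]
      positivity
    have hks := Φ.map_target (htt k hk)
    have h1 : Φ.symm (b + t • k) ∈ S ∪ Γ := by
      rw [hM _ hks, Φ.right_inv (htt k hk)]
      exact ⟨hk0.le, W.add_mem hbW (W.smul_mem _ hk.2)⟩
    refine h1.resolve_right fun h2 => ?_
    have h3 := ((hB _ hks).mp h2).2
    rw [Φ.right_inv (htt k hk)] at h3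
    exact hk0.ne' h3
  have hpos : ∀ y ∈ S, 0 < 1 - ‖y‖ ^ 2 := fun y hy => by
    have : ‖y‖ < 1 := by simpa using hS_ball hy
    nlinarith [norm_nonneg y]
  set g : Eucl (n + 1) → ℝ := fun y => ‖y‖ ^ 2 + 1 - 2 * ⟪y, c⟫ with hg
  have hψ : ContinuousOn (fun k : Eucl (n + 1) => Φ.symm (b + t • k)) D :=
    Φ.symm.continuousOn.comp (by fun_prop) fun k hk => htt k hk
  have hcont : ContinuousOn (fun k : Eucl (n + 1) =>
      g (Φ.symm (b + t • k)) / (1 - ‖Φ.symm (b + t • k)‖ ^ 2)) D := by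
    refine ContinuousOn.div ?_ ?_ fun k hk => (hpos _ (hDS k hk)).ne'
    · exact ((hψ.norm.pow 2).add continuousOn_const).sub
        (continuousOn_const.mul (ContinuousOn.inner (𝕜 := ℝ) hψ continuousOn_const))
    · exact continuousOn_const.sub (hψ.norm.pow 2)
  have heD : e ∈ D := ⟨Metric.mem_closedBall_self (by norm_num), heW⟩
  obtain ⟨k, hkD, hkmin⟩ := hDc.exists_isMinOn ⟨e, heD⟩ hcont
  set x := Φ.symm (b + t • k) with hx
  set l : ℝ := g x / (1 - ‖x‖ ^ 2) with hl
  have hxS : x ∈ S := hDS k hkD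
  have hxpos := hpos x hxS
  have hgl : g x = l * (1 - ‖x‖ ^ 2) := by rw [hl, div_mul_cancel₀ _ hxpos.ne']
  have hl0 : l < 0 := (hkmin heD).trans_lt (div_neg_of_neg_of_pos hce (hpos _ (hDS e heD)))
  -- The minimum is negative while `g` is positive on the rim, so it is attained inside and is a
  -- local minimum on `S`.
  have hke : ‖k - e‖ < 1 / 2 := by
    refine lt_of_le_of_ne (by simpa [dist_eq_norm] using hkD.1) fun h => ?_
    have h1 : 0 < g x := hcr k hkD.2 h
    rw [hgl] at h1
    nlinarith
  have hxs : x ∈ Φ.source := Φ.map_target (htt k hkD)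
  have hΦx : Φ x = b + t • k := Φ.right_inv (htt k hkD)
  refine hS_min.no_negative_localMin hm hmn hS_ball hS_sub hxS hl0 c ?_ ?_
  · have : ‖x‖ ^ 2 + 1 - 2 * ⟪x, c⟫ = l * (1 - ‖x‖ ^ 2) := hgl
    linarith
  · have hnear : ∀ᶠ y in 𝓝 x, ‖t⁻¹ • (Φ y - b) - e‖ < 1 / 2 := by
      have h1 : ContinuousAt (fun y => ‖t⁻¹ • (Φ y - b) - e‖) x :=
        ((((Φ.continuousAt hxs).sub continuousAt_const).const_smul t⁻¹).sub
          continuousAt_const).norm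
      refine h1.eventually_lt continuousAt_const ?_
      rw [hΦx, add_sub_cancel_left, inv_smul_smul₀ ht.ne']
      exact hke
    filter_upwards [hnear, Φ.open_source.mem_nhds hxs] with y hy hys hyS
    have hyW : Φ y ∈ W := (mem_halfSpace_iff.mp ((hM y hys).mp (Or.inl hyS))).2
    have hkyD : t⁻¹ • (Φ y - b) ∈ D :=
      ⟨by simpa [dist_eq_norm] using hy.le, W.smul_mem _ (W.sub_mem hyW hbW)⟩
    have hy' : Φ.symm (b + t • t⁻¹ • (Φ y - b)) = y := by
      rw [smul_inv_smul₀ ht.ne', add_sub_cancel, Φ.left_inv hys]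
    have h1 : l ≤ g y / (1 - ‖y‖ ^ 2) := by
      have h := hkmin hkyD
      simp only [Set.mem_ofPred_eq, hy'] at h
      exact h
    rw [le_div_iff₀ (hpos y hyS)] at h1
    have h2 : g y = ‖y‖ ^ 2 + 1 - 2 * ⟪y, c⟫ := rfl
    linarith

end HypMin

/-- A minimal submanifold `S` of hyperbolic space (unit ball model) that extends to a `C^1`
submanifold `S ∪ Γ` with boundary `Γ` in the sphere at infinity meets that sphere orthogonally. -/
theorem theorem1 (n m : ℕ) (hm : 1 ≤ m) (hmn : m ≤ n + 1)
    (S Γ : Set (HypMin.Eucl (n + 1)))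
    (hS_ball : S ⊆ Metric.ball 0 1)
    (hΓ_sphere : Γ ⊆ Metric.sphere 0 1)
    (hS_sub : HypMin.IsSubmanifoldWithBoundary 2 m S ∅)
    (hS_min : HypMin.IsMinimal m S)
    (hext : HypMin.IsSubmanifoldWithBoundary 1 m (S ∪ Γ) Γ) :
    ∀ p ∈ Γ, HypMin.MeetsOrthogonallyAt (S ∪ Γ) (Metric.sphere 0 1) p := by
  intro p hpΓ
  obtain ⟨Φ, hps, hΦ, hΨ, hM, hB⟩ := hext.2 p (Or.inr hpΓ)
  have hΦd : DifferentiableAt ℝ Φ p :=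
    (hΦ.contDiffAt (Φ.open_source.mem_nhds hps)).differentiableAt (by simp)
  have hΨd : DifferentiableAt ℝ Φ.symm (Φ p) :=
    (hΨ.contDiffAt (Φ.open_target.mem_nhds (Φ.map_source hps))).differentiableAt (by simp)
  have hp : p ∈ HypMin.tangentSpaceAt (S ∪ Γ) p :=
    HypMin.map_coordSubspace_le_tangentSpaceAt Φ hps hΨd hM (Or.inr hpΓ)
      (HypMin.mem_map_coordSubspace hm hmn hS_ball hΓ_sphere hS_sub hS_min Φ hpΓ hps hΦd hΨd hM hB)
  refine (HypMin.tangentSpaceAt_sphere_orthogonal_le (by simpa using hΓ_sphere hpΓ)).trans ?_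
  rw [Submodule.span_singleton_le_iff_mem]
  exact hp
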